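/- A \emph{4-regular graph gadget} is a finite graph (parallel edges and loops allowed) together with four half-edges labelled $0,1,2,3$, each incident with exactly one vertex, such that every vertex has degree $4$, where loops count twice and half-edges once. A \emph{route} joining half-edges $a$ and $b$ is a trail (no repeated edges, repeated vertices allowed) that starts with the half-edge $a$ and ends with the half-edge $b$; a route and its reversal are identified. For $\{a,b,c,d\}=\{0,1,2,3\}$, let $\mathrm{VR}(\{a,b\},\{c,d\})$ be the set of all pairs consisting of a route joining $a$ and $b$ and a route joining $c$ and $d$ which together travel every edge exactly once. Put $N=|\mathrm{VR}(\{0,1\},\{2,3\})|+|\mathrm{VR}(\{0,2\},\{1,3\})|+|\mathrm{VR}(\{0,3\},\{1,2\})|$. If $N\neq 0$, the \emph{signature} of the gadget is the triple $$\frac1N\Big(|\mathrm{VR}(\{0,1\},\{2,3\})|,\ |\mathrm{VR}(\{0,2\},\{1,3\})|,\ |\mathrm{VR}(\{0,3\},\{1,2\})|\Big).$$ Let $S\subset\mathbb{R}^3$ be the set of all vectors obtained by permuting the coordinates of some $(\alpha,\beta,\gamma)$ with $\alpha\ge\beta\ge\gamma\ge 0$, $\alpha+\beta+\gamma=1$ and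 $\gamma\ge f(\beta)$, where $$f(x)=\tfrac12(1-x)\Big(1-\exp\Big(\frac{2x}{x-1}\Big)\Big).$$ \textbf{Theorem.} For every $\vec s\in S$ and every $\varepsilon>0$ there is a 4-regular graph gadget which has a signature $\vec s\,'$ with $\|\vec s-\vec s\,'\|_1\le\varepsilon$. -/

import Mathlib

/-- A 4-regular graph gadget: a finite mixed (multi)graph with vertex set `V`, edge set `E` (the two
ends of an edge are given by `ends`; parallel edges and loops are permitted) and four labelled
half-edges `0, 1, 2, 3`, the half-edge `i` being incident with the single vertex `half i`, such that
every vertex has degree 4, where loops count twice and half-edges once. -/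
structure GraphGadget where
  V : Type
  E : Type
  finite_V : Finite V
  finite_E : Finite E
  ends : E → Sym2 V
  half : Fin 4 → V
  regular : ∀ v : V,
    {e : E | v ∈ ends e}.ncard + {e : E | ends e = s(v, v)}.ncard
      + {i : Fin 4 | half i = v}.ncard = 4

namespace GraphGadget

/-- `G.IsWalk u l w`: traversing the edges of `l` in order leads from the vertex `u` to the vertex
`w`. The starting vertex and the edges determine all the vertices that are visited, so a walk is
recorded by its list of edges. -/
def IsWalk (G : GraphGadget) : G.V → List G.E → G.V → Prop
  | u, [], w => u = w
  | u, e :: l, w => ∃ v : G.V, G.ends e = s(u, v) ∧ G.IsWalk v l w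

/-- `l` lists the edges of a route `r(a, b)`: a trail (no repeated edges, repeated vertices
allowed) that starts with the half-edge `a` and ends with the half-edge `b`. -/
def IsRoute (G : GraphGadget) (a b : Fin 4) (l : List G.E) : Prop :=
  G.IsWalk (G.half a) l (G.half b) ∧ l.Nodup

/-- The valid sets of routes of type `{{a, b}, {c, d}}`, for `a, b, c, d` the four labels in some
order: a route joining `a` and `b` and a route joining `c` and `d` which together travel every edge
exactly once. Routes are undirected; each is represented by its unique orientation from `a` to `b`,
respectively from `c` to `d`. -/
def VR (G : GraphGadget) (a b c d : Fin 4) : Set (List G.E × List G.E) :=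
  {p | G.IsRoute a b p.1 ∧ G.IsRoute c d p.2 ∧
    (p.1 ++ p.2).Nodup ∧ ∀ e : G.E, e ∈ p.1 ++ p.2}

/-- The numbers of valid sets of routes of the types `{{0,1},{2,3}}`, `{{0,2},{1,3}}`,
`{{0,3},{1,2}}`. -/
noncomputable def routeCount (G : GraphGadget) : Fin 3 → ℕ :=
  ![(G.VR 0 1 2 3).ncard, (G.VR 0 2 1 3).ncard, (G.VR 0 3 1 2).ncard]

/-- `s` is the signature of `G`: the numbers of valid sets of routes of the three types, divided by
their sum `N`. A gadget without any valid set of routes (`N = 0`) has no signature. -/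
def HasSignature (G : GraphGadget) (s : Fin 3 → ℝ) : Prop :=
  (∑ j, G.routeCount j) ≠ 0 ∧
    ∀ i, s i = (G.routeCount i : ℝ) / ((∑ j, G.routeCount j : ℕ) : ℝ)

end GraphGadget

/-- `f(x) = (1/2) (1 - x) (1 - exp (2x / (x - 1)))`. -/
noncomputable def boundaryFun (x : ℝ) : ℝ :=
  1 / 2 * (1 - x) * (1 - Real.exp (2 * x / (x - 1)))

/-- The region `S`: all vectors arising by a permutation of coordinates from some `(α, β, γ)` with
`α ≥ β ≥ γ ≥ 0`, `α + β + γ = 1` and `γ ≥ f(β)`. -/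
def signatureRegion : Set (Fin 3 → ℝ) :=
  {s | ∃ (σ : Equiv.Perm (Fin 3)) (α β γ : ℝ),
    α ≥ β ∧ β ≥ γ ∧ γ ≥ 0 ∧ α + β + γ = 1 ∧ γ ≥ boundaryFun β ∧ s = ![α, β, γ] ∘ σ}

/-!
Let `N₀, N₁, N₂` be the numbers of valid sets of routes of the three types, and let
`u = N₀ / (N₁ + N₂)` and `v = (N₁ - N₂) / (N₁ + N₂)`. Joining two half-edges of one gadget with two
of another adds the values of `u` and multiplies those of `v`. A chain of `m - 1` single vertices
has the coordinates `((m - 1) / 2, 0)`, hence after a relabelling `(1 / m, 1 - 2 / m)`; the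
compositions of copies of these have limit points `(t, exp (-2 * t))` for all `t ≥ 0`. Adding one
more vertex to such a gadget and relabelling turns this curve into the segment `v = 1 - 2 * u`,
`0 ≤ u ≤ 1 / 2`. The products of points of the segment and of the curve fill the region
`0 ≤ u`, `0 ≤ v`, `1 - 2 * u ≤ v ≤ exp (-2 * u)`. A triple `(β, α, γ)` with `(α, β, γ)` as in the
definition of `S` lies in it, the condition `γ ≥ f(β)` being the upper bound for `v`.
-/

namespace GraphGadget

theorem ncard_eq_sum_ncard_preimage {ι α β : Type*} [Fintype ι] {f : ι → α → β} {T : Set β}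
    (hT : T.Finite) (hf : Function.Injective (Function.uncurry f))
    (hfT : ∀ p ∈ T, ∃ i q, f i q = p) : T.ncard = ∑ i, (f i ⁻¹' T).ncard := by
  have := hT.to_subtype
  have (i : ι) : Finite (f i ⁻¹' T) :=
    (hT.preimage fun q _ r _ h => (Prod.mk.inj (@hf (i, q) (i, r) h)).2).to_subtype
  have e : (Σ i, f i ⁻¹' T) ≃ T := by
    refine Equiv.ofBijective (fun x => ⟨f x.1 x.2, x.2.2⟩) ⟨?_, ?_⟩
    · rintro ⟨i, q, hq⟩ ⟨j, r, hr⟩ h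
      obtain ⟨rfl, rfl⟩ := Prod.mk.inj (@hf (i, q) (j, r) (congrArg Subtype.val h))
      rfl
    · rintro ⟨p, hp⟩
      obtain ⟨i, q, rfl⟩ := hfT p hp
      exact ⟨⟨i, q, hp⟩, rfl⟩
  rw [← Nat.card_coe_set_eq, ← Nat.card_congr e, Nat.card_sigma]
  rfl

/-- `l` lists every element of `α` exactly once. -/
def Exhausts {α : Type*} (l : List α) : Prop := l.Nodup ∧ ∀ e, e ∈ l

theorem Exhausts.perm_iff {α : Type*} {l m : List α} (h : l.Perm m) :
    Exhausts l ↔ Exhausts m := by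
  simp only [Exhausts, h.nodup_iff, h.mem_iff]

section Walks

variable (G : GraphGadget)

theorem isWalk_append {u w : G.V} {l m : List G.E} :
    G.IsWalk u (l ++ m) w ↔ ∃ v, G.IsWalk u l v ∧ G.IsWalk v m w := by
  induction l generalizing u with
  | nil => simp [IsWalk]
  | cons e l ih =>
    simp only [List.cons_append, IsWalk, ih]
    tauto

theorem IsWalk.reverse {G : GraphGadget} {u w : G.V} {l : List G.E} (h : G.IsWalk u l w) :
    G.IsWalk w l.reverse u := by
  induction l generalizing u with
  | nil => exact h.symm
  | cons e l ih =>
    obtain ⟨v, he, h⟩ := h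
    rw [List.reverse_cons, isWalk_append]
    exact ⟨v, ih h, u, he.trans Sym2.eq_swap, rfl⟩

theorem mem_VR {a b c d : Fin 4} {p : List G.E × List G.E} :
    p ∈ G.VR a b c d ↔ G.IsWalk (G.half a) p.1 (G.half b) ∧ G.IsWalk (G.half c) p.2 (G.half d) ∧
      Exhausts (p.1 ++ p.2) := by
  constructor
  · rintro ⟨h₁, h₂, h⟩
    exact ⟨h₁.1, h₂.1, h⟩
  · rintro ⟨h₁, h₂, h⟩
    exact ⟨⟨h₁, h.1.of_append_left⟩, ⟨h₂, h.1.of_append_right⟩, h⟩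

theorem finite_VR (a b c d : Fin 4) : (G.VR a b c d).Finite := by
  classical
  have := G.finite_E
  have := Fintype.ofFinite G.E
  have hf : {l : List G.E | l.Nodup}.Finite :=
    Set.finite_coe_iff.1 (inferInstanceAs (Finite {l : List G.E // l.Nodup}))
  exact (hf.prod hf).subset fun p hp => ⟨hp.1.2, hp.2.1.2⟩

theorem VR_image_swap (a b c d : Fin 4) : Prod.swap '' G.VR a b c d = G.VR c d a b := by
  ext ⟨l, m⟩
  rw [Set.image_swap_eq_preimage_swap]
  simp only [Set.mem_preimage, mem_VR, Prod.swap,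
    Exhausts.perm_iff (List.perm_append_comm (l₁ := l))]
  tauto

theorem ncard_VR_swap (a b c d : Fin 4) : (G.VR a b c d).ncard = (G.VR c d a b).ncard := by
  rw [← VR_image_swap, Set.ncard_image_of_injective _ Prod.swap_injective]

theorem map_reverse_mem_VR {a b c d : Fin 4} {p : List G.E × List G.E} (hp : p ∈ G.VR a b c d) :
    p.map id List.reverse ∈ G.VR a b d c := by
  rw [mem_VR] at hp ⊢
  exact ⟨hp.1, hp.2.1.reverse,
    (Exhausts.perm_iff (p.2.reverse_perm.append_left p.1)).2 hp.2.2⟩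

theorem ncard_VR_reverse_right (a b c d : Fin 4) :
    (G.VR a b d c).ncard = (G.VR a b c d).ncard := by
  have hinj : Function.Injective (Prod.map id List.reverse : List G.E × List G.E → _) :=
    Function.injective_id.prodMap List.reverse_injective
  exact le_antisymm
    (Set.ncard_le_ncard_of_injOn _ (fun _ => G.map_reverse_mem_VR) hinj.injOn (G.finite_VR _ _ _ _))
    (Set.ncard_le_ncard_of_injOn _ (fun _ => G.map_reverse_mem_VR) hinj.injOn (G.finite_VR _ _ _ _))

theorem ncard_VR_reverse_left (a b c d : Fin 4) :
    (G.VR b a c d).ncard = (G.VR a b c d).ncard := by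
  rw [ncard_VR_swap, ncard_VR_reverse_right, ncard_VR_swap]

theorem ncard_VR_zero_succ {i : Fin 3} {c d : Fin 4} (h : [0, i.succ, c, d].Nodup) :
    (G.VR 0 i.succ c d).ncard = G.routeCount i := by
  fin_cases i <;> fin_cases c <;> fin_cases d <;>
    first
    | exact absurd h (by decide)
    | rfl
    | exact G.ncard_VR_reverse_right _ _ _ _

end Walks

section Relabel

/-- The gadget `G` with its half-edges relabelled: the half-edge `i` of `G.relabel π` is the
half-edge `π i` of `G`. -/
def relabel (G : GraphGadget) (π : Equiv.Perm (Fin 4)) : GraphGadget where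
  __ := G
  half := G.half ∘ π
  regular v := by
    refine (congrArg _ ?_).trans (G.regular v)
    exact Set.ncard_preimage_of_injective_subset_range (s := {i | G.half i = v}) π.injective
      (by simp)

variable (G : GraphGadget)

theorem isWalk_relabel (π : Equiv.Perm (Fin 4)) (u w : G.V) (l : List G.E) :
    (G.relabel π).IsWalk u l w ↔ G.IsWalk u l w := by
  induction l generalizing u with
  | nil => rfl
  | cons e l ih => exact exists_congr fun v => and_congr_right fun _ => ih v

theorem ncard_VR_relabel (π : Equiv.Perm (Fin 4)) (a b c d : Fin 4) :
    ((G.relabel π).VR a b c d).ncard = (G.VR (π a) (π b) (π c) (π d)).ncard := by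
  refine congrArg Set.ncard (Set.ext fun p => ?_)
  exact and_congr (and_congr_left' (isWalk_relabel G π _ _ _))
    (and_congr_left' (and_congr_left' (isWalk_relabel G π _ _ _)))

/-- The gadget `G` with its half-edges `1, 2, 3` permuted by `σ`, the half-edge `0` being kept.
Since a type of valid sets of routes is determined by the partner of `0`, this permutes the three
types by `σ`. -/
def permute (σ : Equiv.Perm (Fin 3)) : GraphGadget :=
  G.relabel (Equiv.Perm.decomposeFin.symm (0, σ))

theorem routeCount_permute (σ : Equiv.Perm (Fin 3)) :
    (G.permute σ).routeCount = G.routeCount ∘ σ := by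
  set π : Equiv.Perm (Fin 4) := Equiv.Perm.decomposeFin.symm (0, σ) with hπ
  have h0 : π 0 = 0 := Equiv.Perm.decomposeFin_symm_apply_zero 0 σ
  have hsucc (i : Fin 3) : π i.succ = (σ i).succ := by
    simp [hπ, Equiv.Perm.decomposeFin_symm_apply_succ]
  have key {i : Fin 3} {c d : Fin 4} (h : [0, i.succ, c, d].Nodup) :
      (G.permute σ).routeCount i = G.routeCount (σ i) := by
    have h' : [0, (σ i).succ, π c, π d].Nodup := by
      simpa only [List.map, h0, hsucc] using h.map π.injective
    rw [← (G.permute σ).ncard_VR_zero_succ h, permute, ncard_VR_relabel, ← hπ, h0, hsucc,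
      G.ncard_VR_zero_succ h']
  funext i
  fin_cases i
  · exact key (c := 2) (d := 3) (by decide)
  · exact key (c := 1) (d := 3) (by decide)
  · exact key (c := 1) (d := 2) (by decide)

theorem HasSignature.permute {G : GraphGadget} {s : Fin 3 → ℝ} (h : G.HasSignature s)
    (σ : Equiv.Perm (Fin 3)) : (G.permute σ).HasSignature (s ∘ σ) := by
  have hsum : ∑ j, (G.permute σ).routeCount j = ∑ j, G.routeCount j := by
    rw [routeCount_permute]
    exact Equiv.sum_comp σ G.routeCount
  refine ⟨hsum ▸ h.1, fun i => ?_⟩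
  rw [hsum, routeCount_permute]
  exact h.2 (σ i)

end Relabel

section Glue

/-- The side on which a half-edge of `glue G` lies. -/
def side : Fin 4 → Bool := ![false, false, true, true]

/-- The half-edge `port s i` of the gadget on side `s` becomes one end of the link `i` in `glue G`:
the half-edges `2, 3` on side `false` are joined with the half-edges `0, 1` on side `true`. -/
def port : Bool → Bool → Fin 4
  | false, false => 2
  | false, true => 3
  | true, false => 0
  | true, true => 1

theorem port_injective (s : Bool) : Function.Injective (port s) := by
  revert s
  decide

theorem range_port (s : Bool) : Set.range (port s) = {k | side k ≠ s} := by
  ext k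
  revert s k
  decide

/-- The ends of the edges of `glue G`, the edge `.inr i` being the link `i`. -/
def glueEnds (G : Bool → GraphGadget) : (Σ s, (G s).E) ⊕ Bool → Sym2 (Σ s, (G s).V)
  | .inl e => ((G e.1).ends e.2).map (Sigma.mk e.1)
  | .inr i => s(⟨false, (G false).half (port false i)⟩, ⟨true, (G true).half (port true i)⟩)

variable {G : Bool → GraphGadget} {s t : Bool}

theorem glueEnds_inl_eq_iff {e : (G s).E} {u : (G s).V} {x : Σ s, (G s).V} :
    glueEnds G (.inl ⟨s, e⟩) = s(⟨s, u⟩, x) ↔ ∃ v, x = ⟨s, v⟩ ∧ (G s).ends e = s(u, v) := by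
  rcases x with ⟨t, w⟩
  rw [glueEnds]
  generalize (G s).ends e = z
  induction z with | _ a b
  simp only [Sym2.map_mk, Sym2.eq_iff]
  aesop

theorem eq_of_mem_glueEnds_inl {e : (G t).E} {u : (G s).V}
    (h : ⟨s, u⟩ ∈ glueEnds G (.inl ⟨t, e⟩)) : t = s := by
  obtain ⟨_, _, h⟩ := Sym2.mem_map.1 h
  exact congrArg Sigma.fst h

theorem glueEnds_link (hst : s ≠ t) (i : Bool) :
    glueEnds G (.inr i) = s(⟨s, (G s).half (port s i)⟩, ⟨t, (G t).half (port t i)⟩) := by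
  cases s <;> cases t
  · exact absurd rfl hst
  · rfl
  · exact Sym2.eq_swap
  · exact absurd rfl hst

theorem setOf_mem_glueEnds (v : (G s).V) :
    {e | (⟨s, v⟩ : Σ s, (G s).V) ∈ glueEnds G e} =
      (fun e => .inl ⟨s, e⟩) '' {e | v ∈ (G s).ends e} ∪
        .inr '' {i | (G s).half (port s i) = v} := by
  ext (⟨t, e⟩ | i)
  · constructor
    · intro h
      obtain rfl := eq_of_mem_glueEnds_inl h
      obtain ⟨w, hw, hwv⟩ := Sym2.mem_map.1 h
      obtain rfl := sigma_mk_injective hwv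
      exact .inl ⟨e, hw, rfl⟩
    · rintro (⟨e, he, ⟨⟩⟩ | ⟨i, -, ⟨⟩⟩)
      exact Sym2.mem_map.2 ⟨v, he, rfl⟩
  · simp [glueEnds_link (Bool.not_ne_self s).symm, eq_comm]

theorem setOf_glueEnds_eq_loop (v : (G s).V) :
    {e | glueEnds G e = s(⟨s, v⟩, ⟨s, v⟩)} =
      (fun e => .inl ⟨s, e⟩) '' {e | (G s).ends e = s(v, v)} := by
  ext (⟨t, e⟩ | i)
  · constructor
    · intro h
      rw [Set.mem_ofPred_eq] at h
      obtain rfl := eq_of_mem_glueEnds_inl (h ▸ Sym2.mem_mk_left _ _)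
      obtain ⟨w, hw, he⟩ := glueEnds_inl_eq_iff.1 h
      obtain rfl := sigma_mk_injective hw
      exact ⟨e, he, rfl⟩
    · rintro ⟨e, he, ⟨⟩⟩
      exact glueEnds_inl_eq_iff.2 ⟨v, rfl, he⟩
  · simp [glueEnds_link (Bool.not_ne_self s).symm]

theorem ncard_half_add_ncard_port (A : GraphGadget) (s : Bool) (v : A.V) :
    {k | side k = s ∧ A.half k = v}.ncard + {i | A.half (port s i) = v}.ncard =
      {k | A.half k = v}.ncard := by
  rw [← Set.ncard_image_of_injective {i | A.half (port s i) = v} (port_injective s),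
    ← Set.ncard_inter_add_ncard_sdiff_eq_ncard {k | A.half k = v} {k | side k = s}]
  congr 2
  · ext k
    exact and_comm
  · change port s '' (port s ⁻¹' {k | A.half k = v}) = _
    rw [Set.image_preimage_eq_inter_range, range_port]
    rfl

theorem glue_regular (G : Bool → GraphGadget) (x : Σ s, (G s).V) :
    {e | x ∈ glueEnds G e}.ncard + {e | glueEnds G e = s(x, x)}.ncard
      + {k | (⟨side k, (G (side k)).half k⟩ : Σ s, (G s).V) = x}.ncard = 4 := by
  obtain ⟨s, v⟩ := x
  have := (G s).finite_E
  have hinj : Function.Injective (fun e => .inl ⟨s, e⟩ : (G s).E → (Σ s, (G s).E) ⊕ Bool) :=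
    Sum.inl_injective.comp sigma_mk_injective
  have hdisj : Disjoint ((fun e => .inl ⟨s, e⟩ : (G s).E → (Σ s, (G s).E) ⊕ Bool) ''
      {e | v ∈ (G s).ends e}) (.inr '' {i | (G s).half (port s i) = v}) := by
    simp [Set.disjoint_left]
  have hhalf : {k | (⟨side k, (G (side k)).half k⟩ : Σ s, (G s).V) = ⟨s, v⟩} =
      {k | side k = s ∧ (G s).half k = v} := by
    ext k
    simp only [Set.mem_ofPred_eq, Sigma.mk.injEq]
    refine and_congr_right ?_
    rintro rfl
    exact heq_iff_eq
  rw [setOf_mem_glueEnds, setOf_glueEnds_eq_loop, hhalf, Set.ncard_union_eq hdisj,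
    Set.ncard_image_of_injective _ hinj, Set.ncard_image_of_injective _ hinj,
    Set.ncard_image_of_injective _ Sum.inr_injective]
  have hdeg := (G s).regular v
  rw [← ncard_half_add_ncard_port (G s) s v] at hdeg
  omega

/-- The composition of two gadgets: the disjoint union of `G false` and `G true`, in which the
half-edges `2, 3` of `G false` are joined with the half-edges `0, 1` of `G true` by two links. The
half-edges `0, 1` of `G false` and `2, 3` of `G true` remain. Indexing the two gadgets by `Bool`
lets the symmetric arguments about the two sides be made once. -/
abbrev glue (G : Bool → GraphGadget) : GraphGadget where
  V := Σ s, (G s).V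
  E := (Σ s, (G s).E) ⊕ Bool
  finite_V := have := fun s => (G s).finite_V; inferInstance
  finite_E := have := fun s => (G s).finite_E; inferInstance
  ends := glueEnds G
  half k := ⟨side k, (G (side k)).half k⟩
  regular := glue_regular G

theorem half_glue {a : Fin 4} (ha : side a = s) : (glue G).half a = ⟨s, (G s).half a⟩ := by
  subst ha
  rfl

/-- A list of edges of the gadget on side `s`, as a list of edges of `glue G`. -/
def lift (G : Bool → GraphGadget) (s : Bool) (l : List (G s).E) : List (glue G).E :=
  l.map fun e => .inl ⟨s, e⟩

/-- One of the two edges of `glue G` between its two sides. -/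
def link (G : Bool → GraphGadget) (i : Bool) : (glue G).E := .inr i

theorem lift_append (l m : List (G s).E) : lift G s (l ++ m) = lift G s l ++ lift G s m :=
  List.map_append

theorem lift_injective : Function.Injective (lift G s) :=
  List.map_injective_iff.2 (Sum.inl_injective.comp sigma_mk_injective)

theorem link_notMem_lift (l : List (G s).E) (i : Bool) : link G i ∉ lift G s l := by
  simp [lift, link]

theorem lift_append_link_inj {l l' : List (G s).E} {i i' : Bool} {L L' : List (glue G).E} :
    lift G s l ++ link G i :: L = lift G s l' ++ link G i' :: L' ↔ l = l' ∧ i = i' ∧ L = L' := by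
  induction l generalizing l' with
  | nil => cases l' <;> simp [lift, link]
  | cons e l ih =>
    cases l' with
    | nil => simp [lift, link]
    | cons e' l' =>
      simp only [lift, link] at ih
      simp [lift, link, ih, and_assoc]

theorem exhausts_glue_iff (hst : s ≠ t) (i : Bool) {l : List (G s).E} {m : List (G t).E}
    {L : List (glue G).E} (hL : L.Perm (lift G s l ++ lift G t m ++ [link G i, link G !i])) :
    Exhausts L ↔ Exhausts l ∧ Exhausts m := by
  have hl : (lift G s l).Nodup ↔ l.Nodup :=
    List.nodup_map_iff (Sum.inl_injective.comp sigma_mk_injective)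
  have hm : (lift G t m).Nodup ↔ m.Nodup :=
    List.nodup_map_iff (Sum.inl_injective.comp sigma_mk_injective)
  have hnodup : L.Nodup ↔ l.Nodup ∧ m.Nodup := by
    rw [hL.nodup_iff, List.nodup_append', List.nodup_append', hl, hm]
    simp [lift, link, List.disjoint_left, hst.symm]
  have hmem : (∀ e, e ∈ L) ↔ (∀ e, e ∈ l) ∧ ∀ e, e ∈ m := by
    simp only [hL.mem_iff]
    constructor
    · exact fun h => ⟨fun e => by simpa [lift, link, hst.symm] using h (.inl ⟨s, e⟩),
        fun e => by simpa [lift, link, hst] using h (.inl ⟨t, e⟩)⟩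
    · rintro ⟨hl, hm⟩ (⟨r, e⟩ | j)
      · obtain rfl | rfl : r = s ∨ r = t :=
          (eq_or_ne r s).imp_right fun h =>
            (Bool.eq_not_of_ne h).trans (Bool.eq_not_of_ne hst.symm).symm
        · simp [lift, hl]
        · simp [lift, hm]
      · cases i <;> cases j <;> simp [link]
  rw [Exhausts, hnodup, hmem]
  exact and_and_and_comm

theorem isWalk_inl_cons {u : (G s).V} {e : (G s).E} {L : List (glue G).E} {x : (glue G).V} :
    (glue G).IsWalk ⟨s, u⟩ (.inl ⟨s, e⟩ :: L) x ↔
      ∃ v, (G s).ends e = s(u, v) ∧ (glue G).IsWalk ⟨s, v⟩ L x := by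
  constructor
  · rintro ⟨y, he, h⟩
    obtain ⟨v, rfl, hv⟩ := glueEnds_inl_eq_iff.1 he
    exact ⟨v, hv, h⟩
  · rintro ⟨v, he, h⟩
    exact ⟨_, glueEnds_inl_eq_iff.2 ⟨v, rfl, he⟩, h⟩

theorem isWalk_lift_iff {u : (G s).V} {l : List (G s).E} {x : (glue G).V} :
    (glue G).IsWalk ⟨s, u⟩ (lift G s l) x ↔ ∃ w, x = ⟨s, w⟩ ∧ (G s).IsWalk u l w := by
  induction l generalizing u with
  | nil => simp [lift, IsWalk, eq_comm]
  | cons e l ih =>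
    refine isWalk_inl_cons.trans ?_
    constructor
    · rintro ⟨v, he, h⟩
      obtain ⟨w, hx, h⟩ := ih.1 h
      exact ⟨w, hx, v, he, h⟩
    · rintro ⟨w, hx, v, he, h⟩
      exact ⟨v, he, ih.2 ⟨w, hx, h⟩⟩

theorem isWalk_lift {u w : (G s).V} {l : List (G s).E} :
    (glue G).IsWalk ⟨s, u⟩ (lift G s l) ⟨s, w⟩ ↔ (G s).IsWalk u l w := by
  simp [isWalk_lift_iff]

theorem isWalk_link_cons (hst : s ≠ t) {u : (G s).V} {i : Bool} {L : List (glue G).E}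
    {x : (glue G).V} :
    (glue G).IsWalk ⟨s, u⟩ (link G i :: L) x ↔
      u = (G s).half (port s i) ∧ (glue G).IsWalk ⟨t, (G t).half (port t i)⟩ L x := by
  constructor
  · rintro ⟨v, hv, h⟩
    rcases Sym2.eq_iff.1 ((glueEnds_link hst i).symm.trans hv) with ⟨hu, rfl⟩ | ⟨-, hu⟩
    · exact ⟨(sigma_mk_injective hu).symm, h⟩
    · exact absurd (congrArg Sigma.fst hu).symm hst
  · rintro ⟨rfl, h⟩
    exact ⟨_, glueEnds_link hst i, h⟩

theorem isWalk_lift_append_link (hst : s ≠ t) {u : (G s).V} {l : List (G s).E} {i : Bool}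
    {L : List (glue G).E} {x : (glue G).V} :
    (glue G).IsWalk ⟨s, u⟩ (lift G s l ++ link G i :: L) x ↔
      (G s).IsWalk u l ((G s).half (port s i)) ∧
        (glue G).IsWalk ⟨t, (G t).half (port t i)⟩ L x := by
  rw [isWalk_append]
  constructor
  · rintro ⟨y, h, h'⟩
    obtain ⟨w, rfl, hl⟩ := isWalk_lift_iff.1 h
    obtain ⟨rfl, hL⟩ := (isWalk_link_cons hst).1 h'
    exact ⟨hl, hL⟩
  · rintro ⟨h, h'⟩
    exact ⟨_, isWalk_lift.2 h, (isWalk_link_cons hst).2 ⟨rfl, h'⟩⟩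

theorem IsWalk.eq_lift_or_exists_link {u : (G s).V} {L : List (glue G).E} {x : (glue G).V}
    (h : (glue G).IsWalk ⟨s, u⟩ L x) :
    (∃ l, L = lift G s l) ∨ ∃ l i L', L = lift G s l ++ link G i :: L' := by
  induction L generalizing u with
  | nil => exact .inl ⟨[], rfl⟩
  | cons e L ih =>
    rcases e with ⟨t, e⟩ | i
    · obtain rfl : t = s := by
        obtain ⟨y, he, -⟩ := h
        exact eq_of_mem_glueEnds_inl (he ▸ Sym2.mem_mk_left _ _)
      obtain ⟨v, -, h⟩ := isWalk_inl_cons.1 h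
      rcases ih h with ⟨l, rfl⟩ | ⟨l, i, L', rfl⟩
      · exact .inl ⟨e :: l, rfl⟩
      · exact .inr ⟨e :: l, i, L', rfl⟩
    · exact .inr ⟨[], i, L, rfl⟩

theorem IsWalk.eq_lift_or_detour {u w : (G s).V} {L : List (glue G).E} (hst : s ≠ t)
    (h : (glue G).IsWalk ⟨s, u⟩ L ⟨s, w⟩) (hL : L.Nodup) :
    (∃ l, L = lift G s l) ∨
      ∃ l i m l', L = lift G s l ++ link G i :: (lift G t m ++ link G (!i) :: lift G s l') := by
  rcases h.eq_lift_or_exists_link with h_lift | ⟨l, i, L, rfl⟩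
  · exact .inl h_lift
  have h := ((isWalk_lift_append_link hst).1 h).2
  rcases h.eq_lift_or_exists_link with ⟨m, rfl⟩ | ⟨m, j, L, rfl⟩
  · simp [isWalk_lift_iff, hst] at h
  have hij : i ≠ j := by
    rintro rfl
    simp [List.nodup_append, List.nodup_cons] at hL
  obtain rfl := Bool.eq_not_of_ne hij.symm
  have h := ((isWalk_lift_append_link hst.symm).1 h).2
  rcases h.eq_lift_or_exists_link with ⟨l', rfl⟩ | ⟨l', k, L, rfl⟩
  · exact .inr ⟨l, i, m, l', rfl⟩
  · cases i <;> cases k <;> simp [List.nodup_append, List.nodup_cons] at hL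

theorem IsWalk.eq_crossing {u : (G s).V} {w : (G t).V} {L : List (glue G).E} (hst : s ≠ t)
    (h : (glue G).IsWalk ⟨s, u⟩ L ⟨t, w⟩) (hL : L.Nodup) :
    ∃ l i m, L = lift G s l ++ link G i :: lift G t m := by
  rcases h.eq_lift_or_exists_link with ⟨l, rfl⟩ | ⟨l, i, L, rfl⟩
  · simp [isWalk_lift_iff, hst.symm] at h
  have h := ((isWalk_lift_append_link hst).1 h).2
  rcases h.eq_lift_or_detour hst.symm hL.of_append_right.of_cons with
    ⟨m, rfl⟩ | ⟨m, j, l', m', rfl⟩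
  · exact ⟨l, i, m, rfl⟩
  · cases i <;> cases j <;> simp [List.nodup_append, List.nodup_cons] at hL

/-- The pair of routes of `glue G` of which the first changes from side `s` to side `t` by the link
`i` and the second by the other link, composed of two routes on each side. -/
def crossing (G : Bool → GraphGadget) (s t i : Bool)
    (q : (List (G s).E × List (G s).E) × List (G t).E × List (G t).E) :
    List (glue G).E × List (glue G).E :=
  (lift G s q.1.1 ++ link G i :: lift G t q.2.1, lift G s q.1.2 ++ link G (!i) :: lift G t q.2.2)

/-- The pair of routes of `glue G` of which the first makes a detour from side `s` through side `t`,
leaving by the link `i` and returning by the other one, and the second stays on side `t`. -/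
def detour (G : Bool → GraphGadget) (s t i : Bool)
    (q : (List (G s).E × List (G s).E) × List (G t).E × List (G t).E) :
    List (glue G).E × List (glue G).E :=
  (lift G s q.1.1 ++ link G i :: (lift G t q.2.1 ++ link G (!i) :: lift G s q.1.2), lift G t q.2.2)

theorem crossing_injective : Function.Injective (Function.uncurry (crossing G s t)) := by
  rintro ⟨i, ⟨l₁, l₂⟩, m₁, m₂⟩ ⟨i', ⟨l₁', l₂'⟩, m₁', m₂'⟩ h
  obtain ⟨rfl, rfl, h₁⟩ := lift_append_link_inj.1 (congrArg Prod.fst h)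
  obtain ⟨rfl, -, h₂⟩ := lift_append_link_inj.1 (congrArg Prod.snd h)
  obtain rfl := lift_injective h₁
  obtain rfl := lift_injective h₂
  rfl

theorem detour_injective : Function.Injective (Function.uncurry (detour G s t)) := by
  rintro ⟨i, ⟨l₁, l₂⟩, m₁, m₂⟩ ⟨i', ⟨l₁', l₂'⟩, m₁', m₂'⟩ h
  obtain ⟨rfl, rfl, h₁⟩ := lift_append_link_inj.1 (congrArg Prod.fst h)
  obtain ⟨rfl, -, h₁⟩ := lift_append_link_inj.1 h₁
  obtain rfl := lift_injective h₁
  obtain rfl := lift_injective (congrArg Prod.snd h)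
  rfl

theorem perm_of_crossing {α : Type*} (x y : α) (l₁ l₂ m₁ m₂ : List α) :
    ((l₁ ++ x :: m₁) ++ (l₂ ++ y :: m₂)).Perm ((l₁ ++ l₂) ++ (m₁ ++ m₂) ++ [x, y]) := by
  classical
  rw [List.perm_iff_count]
  intro e
  simp only [List.count_append, List.count_cons, List.count_nil]
  omega

theorem perm_of_detour {α : Type*} (x y : α) (l₁ l₂ m₁ m₂ : List α) :
    ((l₁ ++ x :: (m₁ ++ y :: l₂)) ++ m₂).Perm ((l₁ ++ l₂) ++ (m₁ ++ m₂) ++ [x, y]) := by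
  classical
  rw [List.perm_iff_count]
  intro e
  simp only [List.count_append, List.count_cons, List.count_nil]
  omega

theorem exhausts_crossing_iff (hst : s ≠ t) (i : Bool) {l₁ l₂ : List (G s).E}
    {m₁ m₂ : List (G t).E} :
    Exhausts ((crossing G s t i ((l₁, l₂), m₁, m₂)).1 ++
        (crossing G s t i ((l₁, l₂), m₁, m₂)).2) ↔
      Exhausts (l₁ ++ l₂) ∧ Exhausts (m₁ ++ m₂) := by
  refine exhausts_glue_iff hst i ?_
  rw [lift_append, lift_append]
  exact perm_of_crossing _ _ _ _ _ _

theorem exhausts_detour_iff (hst : s ≠ t) (i : Bool) {l₁ l₂ : List (G s).E}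
    {m₁ m₂ : List (G t).E} :
    Exhausts ((detour G s t i ((l₁, l₂), m₁, m₂)).1 ++ (detour G s t i ((l₁, l₂), m₁, m₂)).2) ↔
      Exhausts (l₁ ++ l₂) ∧ Exhausts (m₁ ++ m₂) := by
  refine exhausts_glue_iff hst i ?_
  rw [lift_append, lift_append]
  exact perm_of_detour _ _ _ _ _ _

variable {a b c d : Fin 4}

theorem crossing_preimage_VR (hst : s ≠ t) (ha : side a = s) (hb : side b = s) (hc : side c = t)
    (hd : side d = t) (i : Bool) :
    crossing G s t i ⁻¹' (glue G).VR a c b d =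
      (G s).VR a (port s i) b (port s !i) ×ˢ (G t).VR (port t i) c (port t !i) d := by
  ext ⟨⟨l₁, l₂⟩, m₁, m₂⟩
  rw [Set.mem_preimage, mem_VR, exhausts_crossing_iff hst, half_glue ha, half_glue hb,
    half_glue hc, half_glue hd]
  simp only [crossing, isWalk_lift_append_link hst, isWalk_lift, Set.mem_prod, mem_VR]
  tauto

theorem detour_preimage_VR (hst : s ≠ t) (ha : side a = s) (hb : side b = s) (hc : side c = t)
    (hd : side d = t) (i : Bool) :
    detour G s t i ⁻¹' (glue G).VR a b c d =
      (G s).VR a (port s i) (port s !i) b ×ˢ (G t).VR (port t i) (port t !i) c d := by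
  ext ⟨⟨l₁, l₂⟩, m₁, m₂⟩
  rw [Set.mem_preimage, mem_VR, exhausts_detour_iff hst, half_glue ha, half_glue hb,
    half_glue hc, half_glue hd]
  simp only [detour, isWalk_lift_append_link hst, isWalk_lift_append_link hst.symm, isWalk_lift,
    Set.mem_prod, mem_VR]
  tauto

theorem exists_crossing_eq (hst : s ≠ t) (ha : side a = s) (hb : side b = s) (hc : side c = t)
    (hd : side d = t) {p : List (glue G).E × List (glue G).E} (hp : p ∈ (glue G).VR a c b d) :
    ∃ i q, crossing G s t i q = p := by
  obtain ⟨p₁, p₂⟩ := p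
  rw [mem_VR, half_glue ha, half_glue hb, half_glue hc, half_glue hd] at hp
  obtain ⟨h₁, h₂, hE⟩ := hp
  obtain ⟨l₁, i, m₁, rfl⟩ := h₁.eq_crossing hst hE.1.of_append_left
  obtain ⟨l₂, j, m₂, rfl⟩ := h₂.eq_crossing hst hE.1.of_append_right
  have hij : i ≠ j := by
    rintro rfl
    exact List.disjoint_of_nodup_append hE.1 (a := link G i) (by simp) (by simp)
  obtain rfl := Bool.eq_not_of_ne hij.symm
  exact ⟨i, ((l₁, l₂), m₁, m₂), rfl⟩

theorem ncard_VR_glue_cross (hst : s ≠ t) (ha : side a = s) (hb : side b = s) (hc : side c = t)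
    (hd : side d = t) :
    ((glue G).VR a c b d).ncard =
      ∑ i, ((G s).VR a (port s i) b (port s !i)).ncard *
        ((G t).VR (port t i) c (port t !i) d).ncard := by
  rw [ncard_eq_sum_ncard_preimage (finite_VR _ _ _ _ _) crossing_injective
    fun p => exists_crossing_eq hst ha hb hc hd]
  simp only [crossing_preimage_VR hst ha hb hc hd, Set.ncard_prod]

theorem exists_detour_eq (hst : s ≠ t) (ha : side a = s) (hb : side b = s) (hc : side c = t)
    (hd : side d = t) {p : List (glue G).E × List (glue G).E} (hp : p ∈ (glue G).VR a b c d) :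
    (∃ i q, detour G s t i q = p) ∨ ∃ i q, detour G t s i q = p.swap := by
  obtain ⟨p₁, p₂⟩ := p
  rw [mem_VR, half_glue ha, half_glue hb, half_glue hc, half_glue hd] at hp
  obtain ⟨h₁, h₂, hE⟩ := hp
  rcases h₁.eq_lift_or_detour hst hE.1.of_append_left with ⟨l₁, rfl⟩ | ⟨l₁, i, m₁, l₂, rfl⟩ <;>
    rcases h₂.eq_lift_or_detour hst.symm hE.1.of_append_right with
      ⟨m₂, rfl⟩ | ⟨m₂, j, l₃, m₃, rfl⟩
  · exact ((List.mem_append.1 (hE.2 (link G true))).elim (link_notMem_lift _ _)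
      (link_notMem_lift _ _)).elim
  · exact .inr ⟨j, ((m₂, m₃), l₃, l₁), rfl⟩
  · exact .inl ⟨i, ((l₁, l₂), m₁, m₂), rfl⟩
  · refine (List.disjoint_of_nodup_append hE.1 (a := link G i) (by simp) ?_).elim
    cases i <;> cases j <;> simp

theorem link_mem_detour_fst (i : Bool)
    (q : (List (G s).E × List (G s).E) × List (G t).E × List (G t).E) :
    link G true ∈ (detour G s t i q).1 := by
  cases i <;> simp [detour]

theorem link_notMem_detour_snd (i : Bool)
    (q : (List (G s).E × List (G s).E) × List (G t).E × List (G t).E) :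
    link G true ∉ (detour G s t i q).2 :=
  link_notMem_lift _ _

theorem ncard_VR_inter_link_mem_fst (hst : s ≠ t) (ha : side a = s) (hb : side b = s)
    (hc : side c = t) (hd : side d = t) :
    ((glue G).VR a b c d ∩ {p | link G true ∈ p.1}).ncard =
      ∑ i, ((G s).VR a (port s i) (port s !i) b).ncard *
        ((G t).VR (port t i) (port t !i) c d).ncard := by
  rw [ncard_eq_sum_ncard_preimage ((finite_VR _ _ _ _ _).inter_of_left _)
    (detour_injective (s := s) (t := t))]
  · refine Finset.sum_congr rfl fun i _ => ?_
    have huniv : detour G s t i ⁻¹' {p | link G true ∈ p.1} = Set.univ :=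
      Set.eq_univ_of_forall (link_mem_detour_fst i)
    rw [Set.preimage_inter, huniv, Set.inter_univ, detour_preimage_VR hst ha hb hc hd,
      Set.ncard_prod]
  · rintro p ⟨hp, hlink⟩
    rcases exists_detour_eq hst ha hb hc hd hp with h | ⟨i, q, h⟩
    · exact h
    · exact absurd (congrArg Prod.snd h ▸ hlink) (link_notMem_detour_snd i q)

theorem VR_diff_link_mem_fst :
    (glue G).VR a b c d \ {p | link G true ∈ p.1} =
      Prod.swap '' ((glue G).VR c d a b ∩ {p | link G true ∈ p.1}) := by
  rw [Set.image_inter Prod.swap_injective, VR_image_swap, Set.image_swap_eq_preimage_swap]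
  ext p
  refine and_congr_right fun hp => ?_
  have hE := ((mem_VR _).1 hp).2.2
  exact ⟨fun h => (List.mem_append.1 (hE.2 _)).resolve_left h,
    fun h h' => List.disjoint_of_nodup_append hE.1 h' h⟩

theorem ncard_VR_glue_parallel (hst : s ≠ t) (ha : side a = s) (hb : side b = s) (hc : side c = t)
    (hd : side d = t) :
    ((glue G).VR a b c d).ncard =
      ∑ i, ((G s).VR a (port s i) (port s !i) b).ncard *
        ((G t).VR (port t i) (port t !i) c d).ncard +
      ∑ i, ((G t).VR c (port t i) (port t !i) d).ncard *
        ((G s).VR (port s i) (port s !i) a b).ncard := by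
  rw [← Set.ncard_inter_add_ncard_sdiff_eq_ncard _ {p | link G true ∈ p.1} (finite_VR _ _ _ _ _),
    VR_diff_link_mem_fst, Set.ncard_image_of_injective _ Prod.swap_injective,
    ncard_VR_inter_link_mem_fst hst ha hb hc hd, ncard_VR_inter_link_mem_fst hst.symm hc hd ha hb]

theorem routeCount_glue_zero (G : Bool → GraphGadget) :
    (glue G).routeCount 0 =
      (G false).routeCount 0 * ((G true).routeCount 1 + (G true).routeCount 2) +
        ((G false).routeCount 1 + (G false).routeCount 2) * (G true).routeCount 0 := by
  have h := ncard_VR_glue_parallel (G := G) (a := 0) (b := 1) (c := 2) (d := 3)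
    Bool.false_ne_true rfl rfl rfl rfl
  simp only [Fintype.sum_bool, port, Bool.not_true, Bool.not_false] at h
  rw [(G false).ncard_VR_reverse_right 0 2 1 3, (G false).ncard_VR_reverse_right 0 3 1 2,
    (G false).ncard_VR_swap 3 2, (G false).ncard_VR_reverse_right 0 1 2 3,
    (G false).ncard_VR_swap 2 3, (G true).ncard_VR_reverse_left 0 1 2 3,
    (G true).ncard_VR_reverse_left 0 2 1 3, (G true).ncard_VR_swap 2 1,
    (G true).ncard_VR_reverse_right 0 3 1 2] at h
  simp only [routeCount, Matrix.cons_val]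
  linarith

theorem routeCount_glue_one (G : Bool → GraphGadget) :
    (glue G).routeCount 1 =
      (G false).routeCount 1 * (G true).routeCount 1 +
        (G false).routeCount 2 * (G true).routeCount 2 := by
  have h := ncard_VR_glue_cross (G := G) (a := 0) (b := 1) (c := 2) (d := 3)
    Bool.false_ne_true rfl rfl rfl rfl
  simp only [Fintype.sum_bool, port, Bool.not_true, Bool.not_false] at h
  rw [(G true).ncard_VR_swap 1 2] at h
  exact h.trans (add_comm _ _)

theorem routeCount_glue_two (G : Bool → GraphGadget) :
    (glue G).routeCount 2 =
      (G false).routeCount 1 * (G true).routeCount 2 +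
        (G false).routeCount 2 * (G true).routeCount 1 := by
  have h := ncard_VR_glue_cross (G := G) (a := 0) (b := 1) (c := 3) (d := 2)
    Bool.false_ne_true rfl rfl rfl rfl
  simp only [Fintype.sum_bool, port, Bool.not_true, Bool.not_false] at h
  rw [(G true).ncard_VR_swap 1 3] at h
  exact h.trans (add_comm _ _)

end Glue

section Single

/-- The gadget with a single vertex and no edges. -/
def single : GraphGadget where
  V := Unit
  E := Empty
  finite_V := inferInstance
  finite_E := inferInstance
  ends := Empty.elim
  half _ := ()
  regular v := by
    rw [Set.eq_empty_of_isEmpty {e : Empty | v ∈ Empty.elim e},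
      Set.eq_empty_of_isEmpty {e : Empty | Empty.elim e = s(v, v)}]
    simp [Set.ncard_univ]

theorem ncard_VR_single (a b c d : Fin 4) : (single.VR a b c d).ncard = 1 := by
  have : IsEmpty single.E := inferInstanceAs (IsEmpty Empty)
  refine Set.ncard_eq_one.2 ⟨([], []), Set.eq_singleton_iff_unique_mem.2 ⟨?_, ?_⟩⟩
  · exact (mem_VR _).2 ⟨rfl, rfl, List.nodup_nil, isEmptyElim⟩
  · rintro ⟨l, m⟩ -
    exact Prod.ext (Subsingleton.elim _ _) (Subsingleton.elim _ _)

theorem routeCount_single (i : Fin 3) : single.routeCount i = 1 := by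
  fin_cases i <;> exact ncard_VR_single _ _ _ _

end Single

section Coordinates

open Equiv (swap)

/-- The signature of `G`, written as `(x, y, z)`, satisfies `x = u * (y + z)` and
`y - z = v * (y + z)`, where `y + z ≠ 0`. In the coordinates `u` and `v`, gluing is an addition and
a multiplication. -/
def HasCoords (G : GraphGadget) (u v : ℝ) : Prop :=
  0 < (G.routeCount 1 + G.routeCount 2 : ℝ) ∧
    (G.routeCount 0 : ℝ) = u * (G.routeCount 1 + G.routeCount 2) ∧
    (G.routeCount 1 - G.routeCount 2 : ℝ) = v * (G.routeCount 1 + G.routeCount 2)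

variable {A B : GraphGadget} {u v u' v' : ℝ}

theorem hasCoords_single : single.HasCoords (1 / 2) 0 := by
  simp only [HasCoords, routeCount_single, Nat.cast_one]
  norm_num

theorem HasCoords.nonneg (h : A.HasCoords u v) : 0 ≤ u :=
  nonneg_of_mul_nonneg_left (h.2.1 ▸ Nat.cast_nonneg _) h.1

theorem HasCoords.glue (hA : A.HasCoords u v) (hB : B.HasCoords u' v') :
    (glue (Bool.rec A B)).HasCoords (u + u') (v * v') := by
  obtain ⟨hA₀, hA₁, hA₂⟩ := hA
  obtain ⟨hB₀, hB₁, hB₂⟩ := hB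
  rw [HasCoords, routeCount_glue_zero, routeCount_glue_one, routeCount_glue_two]
  push_cast
  refine ⟨?_, ?_, ?_⟩
  · linarith [mul_pos hA₀ hB₀]
  · rw [hA₁, hB₁]
    ring
  · calc _ = ((A.routeCount 1 : ℝ) - A.routeCount 2) * (B.routeCount 1 - B.routeCount 2) := by ring
      _ = _ := by rw [hA₂, hB₂]; ring

theorem HasCoords.permute_swap_zero_one (h : A.HasCoords u 0) :
    (A.permute (swap 0 1)).HasCoords (1 / (2 * u + 1)) (1 - 2 * (1 / (2 * u + 1))) := by
  have hu : 0 < 2 * u + 1 := by linarith [h.nonneg]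
  obtain ⟨h₀, h₁, h₂⟩ := h
  have h₁₂ : (A.routeCount 1 : ℝ) = A.routeCount 2 := by linarith
  have e₂ : (swap 0 1 : Equiv.Perm (Fin 3)) 2 = 2 := by decide
  simp only [HasCoords, routeCount_permute, Function.comp_apply, Equiv.swap_apply_left,
    Equiv.swap_apply_right, e₂, h₁, h₁₂] at h₀ ⊢
  have hw : 1 / (2 * u + 1) * (2 * u + 1) = 1 := one_div_mul_cancel hu.ne'
  refine ⟨by nlinarith, ?_, ?_⟩
  · linear_combination -(A.routeCount 2 : ℝ) * hw
  · linear_combination 2 * (A.routeCount 2 : ℝ) * hw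

/-- The pairs of coordinates of gadgets. -/
def attainable : Set (ℝ × ℝ) := {p | ∃ G : GraphGadget, G.HasCoords p.1 p.2}

theorem add_mul_mem_attainable {p q : ℝ × ℝ} (hp : p ∈ attainable) (hq : q ∈ attainable) :
    (p.1 + q.1, p.2 * q.2) ∈ attainable := by
  obtain ⟨A, hA⟩ := hp
  obtain ⟨B, hB⟩ := hq
  exact ⟨_, hA.glue hB⟩

theorem nsmul_pow_mem_attainable (h : (u, v) ∈ attainable) {k : ℕ} (hk : 1 ≤ k) :
    (k * u, v ^ k) ∈ attainable := by
  induction k, hk using Nat.le_induction with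
  | base => simpa using h
  | succ k _ ih =>
    have := add_mul_mem_attainable ih h
    rwa [← pow_succ, ← add_one_mul, ← Nat.cast_add_one] at this

theorem div_pow_mem_attainable {m k : ℕ} (hm : 2 ≤ m) (hk : 1 ≤ k) :
    ((k / m, (1 - 2 / m) ^ k) : ℝ × ℝ) ∈ attainable := by
  obtain ⟨n, rfl⟩ := Nat.exists_eq_add_of_le' (one_le_two.trans hm)
  have hn : 1 ≤ n := Nat.le_of_succ_le_succ hm
  have h := nsmul_pow_mem_attainable ⟨single, hasCoords_single⟩ hn
  rw [zero_pow (Nat.one_le_iff_ne_zero.1 hn)] at h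
  obtain ⟨G, hG⟩ := h
  have h := nsmul_pow_mem_attainable ⟨_, hG.permute_swap_zero_one⟩ hk
  have hn' : 2 * (n * (1 / 2)) + 1 = ((n + 1 : ℕ) : ℝ) := by
    push_cast
    ring
  simp only [hn'] at h
  rwa [mul_one_div, mul_one_div] at h

theorem line_mem_attainable {p : ℝ × ℝ} (hp : p ∈ attainable) :
    (1 / (2 * p.1 + 2), 1 - 2 * (1 / (2 * p.1 + 2))) ∈ attainable := by
  obtain ⟨G, hG⟩ := hp
  have h := hG.glue hasCoords_single
  rw [mul_zero] at h
  have hu : 2 * (p.1 + 1 / 2) + 1 = 2 * p.1 + 2 := by ring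
  exact ⟨_, hu ▸ h.permute_swap_zero_one⟩

end Coordinates

section Closure

open Filter Topology

theorem tendsto_floor_add_one_div {t : ℝ} (ht : 0 ≤ t) :
    Tendsto (fun m : ℕ => ((⌊t * m⌋₊ + 1 : ℕ) : ℝ) / m) atTop (𝓝 t) := by
  have h := ((tendsto_nat_floor_mul_div_atTop ht).comp
    (tendsto_natCast_atTop_atTop (R := ℝ))).add (tendsto_one_div_atTop_nhds_zero_nat (𝕜 := ℝ))
  rw [add_zero] at h
  refine h.congr fun m => ?_
  simp [add_div]

theorem tendsto_one_add_div_pow_exp_mul {k : ℕ → ℕ} {t : ℝ} (x : ℝ)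
    (hk : Tendsto (fun m => (k m : ℝ) / m) atTop (𝓝 t)) :
    Tendsto (fun m : ℕ => (1 + x / m) ^ k m) atTop (𝓝 (Real.exp (x * t))) := by
  have h := (Real.tendsto_one_add_div_pow_exp x).rpow hk (.inl (Real.exp_pos _).ne')
  rw [← Real.exp_mul] at h
  have hbase : Tendsto (fun m : ℕ => 1 + x / m) atTop (𝓝 (1 + 0)) :=
    (tendsto_const_div_atTop_nhds_zero_nat x).const_add 1
  refine h.congr' ?_
  filter_upwards [eventually_gt_atTop 0, hbase.eventually_const_le (by norm_num : (0 : ℝ) < 1 + 0)]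
    with m hm hm'
  rw [← Real.rpow_natCast, ← Real.rpow_mul hm', mul_div_cancel₀ _ (Nat.cast_pos.2 hm).ne',
    Real.rpow_natCast]

theorem exp_mem_closure_attainable {t : ℝ} (ht : 0 ≤ t) :
    (t, Real.exp (-2 * t)) ∈ closure attainable := by
  have hk := tendsto_floor_add_one_div ht
  refine mem_closure_of_tendsto (hk.prodMk_nhds (tendsto_one_add_div_pow_exp_mul (-2) hk)) ?_
  filter_upwards [eventually_ge_atTop 2] with m hm
  rw [neg_div, ← sub_eq_add_neg]
  exact div_pow_mem_attainable hm (Nat.le_add_left 1 _)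

theorem add_mul_mem_closure_attainable {p q : ℝ × ℝ} (hp : p ∈ closure attainable)
    (hq : q ∈ closure attainable) : (p.1 + q.1, p.2 * q.2) ∈ closure attainable :=
  map_mem_closure₂ (f := fun p q : ℝ × ℝ => (p.1 + q.1, p.2 * q.2)) (by fun_prop) hp hq
    fun _ hp _ hq => add_mul_mem_attainable hp hq

theorem line_mem_closure_attainable {u : ℝ} (hu : 0 ≤ u) (hu' : u ≤ 1 / 2) :
    (u, 1 - 2 * u) ∈ closure attainable := by
  rcases hu.eq_or_lt with rfl | hu
  · simpa using exp_mem_closure_attainable le_rfl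
  obtain ⟨c, hc, rfl⟩ : ∃ c, 0 ≤ c ∧ 1 / (2 * c + 2) = u := by
    refine ⟨1 / (2 * u) - 1, ?_, ?_⟩
    · rw [sub_nonneg, le_div_iff₀ (by linarith)]
      linarith
    · field_simp
      ring
  have hcont : ContinuousAt (fun p : ℝ × ℝ => (1 / (2 * p.1 + 2), 1 - 2 * (1 / (2 * p.1 + 2))))
      (c, Real.exp (-2 * c)) := by
    have hc' : 2 * c + 2 ≠ 0 := by linarith
    exact ContinuousAt.prodMk (by fun_prop (disch := exact hc'))
      (by fun_prop (disch := exact hc'))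
  exact hcont.continuousWithinAt.mem_closure (exp_mem_closure_attainable hc)
    fun _ => line_mem_attainable

theorem mem_closure_attainable {u v : ℝ} (hu : 0 ≤ u) (hv : 0 ≤ v) (huv : 1 - 2 * u ≤ v)
    (hexp : v ≤ Real.exp (-2 * u)) : (u, v) ∈ closure attainable := by
  let g (r : ℝ) : ℝ := (1 - 2 * r) * Real.exp (-2 * (u - r))
  have hg : ContinuousOn g (Set.Icc 0 (min u (1 / 2))) := by fun_prop
  have hg₀ : v ≤ g 0 := by simpa [g] using hexp
  have hg₁ : g (min u (1 / 2)) ≤ v := by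
    rcases min_choice u (1 / 2) with h | h
    · rw [h]
      simpa [g] using huv
    · rw [h]
      simpa [g] using hv
  obtain ⟨r, ⟨hr₀, hr₁⟩, rfl⟩ :=
    intermediate_value_Icc' (le_min hu (by norm_num)) hg ⟨hg₁, hg₀⟩
  have hru : r ≤ u := hr₁.trans (min_le_left _ _)
  have := add_mul_mem_closure_attainable
    (line_mem_closure_attainable hr₀ (hr₁.trans (min_le_right _ _)))
    (exp_mem_closure_attainable (sub_nonneg.2 hru))
  rwa [add_sub_cancel] at this

end Closure

section Signature

/-- The signature with coordinates `p`. -/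
noncomputable def signatureOf (p : ℝ × ℝ) : Fin 3 → ℝ :=
  ![p.1 / (1 + p.1), (1 + p.2) / (2 * (1 + p.1)), (1 - p.2) / (2 * (1 + p.1))]

theorem continuousAt_signatureOf {p : ℝ × ℝ} (hp : 1 + p.1 ≠ 0) :
    ContinuousAt signatureOf p := by
  have hp' : 2 * (1 + p.1) ≠ 0 := by simpa using hp
  refine continuousAt_pi.2 fun i => ?_
  fin_cases i
  · exact ContinuousAt.div (by fun_prop) (by fun_prop) hp
  · exact ContinuousAt.div (by fun_prop) (by fun_prop) hp'
  · exact ContinuousAt.div (by fun_prop) (by fun_prop) hp'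

theorem HasCoords.hasSignature {G : GraphGadget} {u v : ℝ} (h : G.HasCoords u v) :
    G.HasSignature (signatureOf (u, v)) := by
  have hu : 0 < 1 + u := by linarith [h.nonneg]
  obtain ⟨h₀, h₁, h₂⟩ := h
  have hsum : ((∑ j, G.routeCount j : ℕ) : ℝ) =
      (1 + u) * (G.routeCount 1 + G.routeCount 2) := by
    rw [Fin.sum_univ_three]
    push_cast
    linarith
  have hpos := mul_pos hu h₀
  refine ⟨Nat.cast_ne_zero.1 (hsum ▸ hpos.ne'), fun i => ?_⟩
  rw [hsum, eq_div_iff hpos.ne']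
  fin_cases i <;>
  · simp only [signatureOf, Fin.zero_eta, Fin.mk_one, Fin.reduceFinMk, Matrix.cons_val]
    field_simp
    linarith

/-- The signatures of gadgets. -/
def signatures : Set (Fin 3 → ℝ) := {s | ∃ G : GraphGadget, G.HasSignature s}

theorem signatureOf_mem_closure_signatures {p : ℝ × ℝ} (hp : p ∈ closure attainable)
    (hp₀ : 0 ≤ p.1) : signatureOf p ∈ closure signatures :=
  (continuousAt_signatureOf (by linarith)).continuousWithinAt.mem_closure hp
    fun _ ⟨G, hG⟩ => ⟨G, hG.hasSignature⟩

theorem comp_perm_mem_closure_signatures {s : Fin 3 → ℝ} (hs : s ∈ closure signatures)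
    (σ : Equiv.Perm (Fin 3)) : s ∘ σ ∈ closure signatures :=
  map_mem_closure (f := fun s : Fin 3 → ℝ => s ∘ σ) (by fun_prop) hs
    fun _ ⟨G, hG⟩ => ⟨G.permute σ, hG.permute σ⟩

theorem signatureOf_div {x y z : ℝ} (hx : x ≠ 1) (hsum : x + y + z = 1) :
    signatureOf (x / (1 - x), (y - z) / (1 - x)) = ![x, y, z] := by
  have hx' : 1 - x ≠ 0 := sub_ne_zero.2 hx.symm
  have h : 1 + x / (1 - x) = 1 / (1 - x) := by
    field_simp
    ring
  funext i
  fin_cases i <;>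
    simp only [signatureOf, h, Fin.zero_eta, Fin.mk_one, Fin.reduceFinMk, Matrix.cons_val] <;>
    field_simp
  · linarith
  · linarith

theorem signatureRegion_subset_closure : signatureRegion ⊆ closure signatures := by
  rintro s ⟨σ, α, β, γ, hαβ, hβγ, hγ, hsum, hf, rfl⟩
  have hβ : 0 < 1 - β := by linarith
  have hexp : 2 * β / (β - 1) = -2 * (β / (1 - β)) := by
    rw [← neg_sub 1 β]
    field_simp
  have hu : 0 ≤ β / (1 - β) := div_nonneg (hγ.trans hβγ) hβ.le
  have hmem : (β / (1 - β), (α - γ) / (1 - β)) ∈ closure attainable := by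
    refine mem_closure_attainable hu (div_nonneg (by linarith) hβ.le) ?_ ?_
    · rw [le_div_iff₀ hβ, sub_mul, mul_assoc, div_mul_cancel₀ _ hβ.ne']
      linarith
    · rw [boundaryFun, hexp] at hf
      rw [div_le_iff₀ hβ]
      linarith
  have h := signatureOf_mem_closure_signatures hmem hu
  rw [signatureOf_div (by linarith) (by linarith)] at h
  convert comp_perm_mem_closure_signatures h (Equiv.swap 0 1 * σ) using 1
  rw [Equiv.Perm.coe_mul, ← Function.comp_assoc]
  congr 1
  funext i
  fin_cases i <;> rfl

end Signature

end GraphGadget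

theorem mainTheorem6 (s : Fin 3 → ℝ) (hs : s ∈ signatureRegion) (ε : ℝ) (hε : 0 < ε) :
    ∃ (G : GraphGadget) (s' : Fin 3 → ℝ), G.HasSignature s' ∧ ∑ i, |s i - s' i| ≤ ε := by
  have hopen : IsOpen {s' : Fin 3 → ℝ | ∑ i, |s i - s' i| < ε} :=
    isOpen_lt (by fun_prop) continuous_const
  obtain ⟨s', hlt, G, hG⟩ :=
    mem_closure_iff.1 (GraphGadget.signatureRegion_subset_closure hs) _ hopen (by simpa using hε)
  exact ⟨G, s', hG, le_of_lt hlt⟩
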